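/- Let $\xi$ be a random variable with positive integer values for which there are constants $\alpha, V, W > 0$ with $W\ell^{-\alpha} \le \Pr[\xi \ge \ell] \le V\ell^{-\alpha}$ for all integers $\ell \ge 1$, and suppose that $\mathbb{E}\,\xi^2 < 3\,\mathbb{E}\,\xi$ (moments are taken in $[0,\infty]$, so this includes $\mathbb{E}\,\xi^2<\infty$). Let $\phi$ be a random 2-CNF on $n$ variables drawn from the configuration model $\mathbb{C}_n^2(\xi)$: draw degrees $d_1,\dots,d_n$ as independent copies of $\xi$, conditioned on $d_1+\dots+d_n$ being even (that is, redrawn until the sum is even); give the $i$-th variable $d_i$ clones; choose a uniformly random partition of the set of all clones into 2-element sets; and turn each 2-element set into a 2-clause by choosing the polarity of every clone independently and uniformly at random. Then $\phi$ is satisfiable with high probability: $\Pr[\phi \text{ is satisfiable}] \to 1$ as $n \to \infty$, where $n$ ranges over those integers for which $d_1+\dots+d_n$ is even with positive probability (all $n$, except that odd $n$ are excluded when $\xi$ is almost surely odd). -/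

import Mathlib

open MeasureTheory ProbabilityTheory Filter
open scoped ENNReal Topology

noncomputable section

namespace RandomTwoSat

/-- A literal over the variables `v_0, …, v_{n-1}`: a variable with a sign
(`true` for the positive literal, `false` for the negated one). -/
abbrev Literal (n : ℕ) : Type := Fin n × Bool

/-- A 2-clause: an unordered pair of literals (the two may coincide or be complementary). -/
abbrev Clause (n : ℕ) : Type := Sym2 (Literal n)

/-- A 2-CNF on `n` variables: a finite collection of 2-clauses, counted with multiplicity. -/
structure TwoCNF (n : ℕ) : Type where
  clauses : Multiset (Clause n)

instance (n : ℕ) : MeasurableSpace (TwoCNF n) := ⊤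

/-- `φ` is satisfiable: some truth assignment makes, in every clause, some literal true. -/
def TwoCNF.Satisfiable {n : ℕ} (φ : TwoCNF n) : Prop :=
  ∃ a : Fin n → Bool, ∀ C ∈ φ.clauses, ∃ l : Literal n, l ∈ C ∧ a l.1 = l.2

/-- The clones: variable `v_i` has `d i` of them. -/
abbrev Clone {n : ℕ} (d : Fin n → ℕ) : Type := Σ i : Fin n, Fin (d i)

/-- The partitions of `X` into 2-element sets, given by the map that sends each point to
its partner. -/
abbrev Pairing (X : Type) : Type :=
  {f : X → X // Function.Involutive f ∧ ∀ x, f x ≠ x}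

/-- The outcomes of the random choices once the degrees `d` are fixed: a partition of the
clones into 2-element sets, and a polarity for every clone. -/
abbrev Outcome {n : ℕ} (d : Fin n → ℕ) : Type := Pairing (Clone d) × (Clone d → Bool)

/-- The 2-element sets of a partition of the clones, as unordered pairs. -/
def pairs {n : ℕ} {d : Fin n → ℕ} (f : Pairing (Clone d)) : Finset (Sym2 (Clone d)) :=
  Finset.univ.image fun c => s(c, f.1 c)

/-- The formula of an outcome: each 2-element set `{c, c'}` of clones gives one clause, made
of the literals that `c` and `c'` become under the chosen polarities. -/
def toCNF {n : ℕ} (d : Fin n → ℕ) (o : Outcome d) : TwoCNF n :=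
  ⟨(pairs o.1).val.map (Sym2.map fun c => (c.1, o.2 c))⟩

/-- The law of the formula for fixed degrees `d`: the partition of the clones is uniform, and
the polarities are independent fair coins, independent of the partition (that is, the outcome
is uniform). It is the zero measure if the number of clones is odd. -/
def formulaLaw {n : ℕ} (d : Fin n → ℕ) : Measure (TwoCNF n) :=
  letI : MeasurableSpace (Outcome d) := ⊤
  (uniformOn (Set.univ : Set (Outcome d))).map (toCNF d)

/-- The event that the total number of clones is even. -/
def evenSum (n : ℕ) : Set (Fin n → ℕ) := {d | Even (∑ i, d i)}

/-- `n` independent degrees with law `μ`. -/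
def iidDegrees (n : ℕ) (μ : Measure ℕ) : Measure (Fin n → ℕ) := Measure.pi fun _ => μ

/-- The law of the degrees in the configuration model: `n` independent samples from `μ`,
resampled until their sum is even, i.e. conditioned on an even sum. -/
def degreeLaw (n : ℕ) (μ : Measure ℕ) : Measure (Fin n → ℕ) :=
  ProbabilityTheory.cond (iidDegrees n μ) (evenSum n)

/-- The configuration model for 2-CNFs with `n` variables and degree distribution `μ`. -/
def configModel (n : ℕ) (μ : Measure ℕ) : Measure (TwoCNF n) :=
  (degreeLaw n μ).bind formulaLaw

/-- `ξ` is a positive integer valued random variable with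
`W ℓ^(-α) ≤ P[ξ ≥ ℓ] ≤ V ℓ^(-α)` for all integers `ℓ ≥ 1`, where `α, V, W > 0`. -/
structure IsPowerLaw {Ω : Type*} [MeasurableSpace Ω] (P : Measure Ω) (ξ : Ω → ℕ) (α : ℝ) :
    Prop where
  measurable : Measurable ξ
  pos : ∀ᵐ ω ∂P, 1 ≤ ξ ω
  exponent_pos : 0 < α
  tail : ∃ V W : ℝ, 0 < V ∧ 0 < W ∧ ∀ ℓ : ℕ, 1 ≤ ℓ →
    W * (ℓ : ℝ) ^ (-α) ≤ P.real {ω | ℓ ≤ ξ ω} ∧ P.real {ω | ℓ ≤ ξ ω} ≤ V * (ℓ : ℝ) ^ (-α)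

end RandomTwoSat

end

/-! The proof is a first moment bound on obstructions to satisfiability. Read each clause `{c, f c}`
as two implications. An unsatisfiable formula has a literal `x` with `x → ¬x → x`, and from this
cycle one extracts a bicycle: a path of `k` links (pairs of distinct clones of one variable, with
opposite polarities) through distinct variables, whose two ends are matched to further clones of
variables on the path (`exists_isBicycle`).

Fix the degrees. Let `M` be their sum, `D` a bound on them, and `Λ = ∑ dᵢ(dᵢ - 1)` the number of
ordered links. There are at most `Λ^k (kD)²` candidates. Each of the `k + 1` joints costs a factor
`1/q`, with `q` slightly below `M`, and each link a factor `1/2` for the polarities. The expected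
number of bicycles with `k` links is therefore at most `(kD)²/q · (Λ/2q)^k`. By the law of large
numbers `Λ/2M` is at most about `(E ξ² - E ξ)/(2 E ξ)`, which is below 1 exactly when `E ξ² < 3 E
ξ`. The finite second moment also gives `D² = o(n)`, so the sum over `k` vanishes. Paths of length
linear in `n` are cut at a length `K`: the right end is then free, but the geometric factor beats
the polynomial loss.

Conditioning on an even degree sum costs only a constant factor (`exists_le_evenSum`,
`configModel_le`). -/

namespace RandomTwoSat

/-! ### Satisfiability via the implication relation -/

section Implication

variable {V : Type*}

/-- The complementary literal. -/
def negLit (l : V × Bool) : V × Bool := (l.1, !l.2)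

@[simp] theorem negLit_negLit (l : V × Bool) : negLit (negLit l) = l := by
  simp [negLit]

@[simp] theorem negLit_fst (l : V × Bool) : (negLit l).1 = l.1 := rfl

theorem negLit_ne (l : V × Bool) : negLit l ≠ l := by
  intro h
  have := congrArg Prod.snd h
  simp [negLit] at this

theorem reflTransGen_negLit {r : V × Bool → V × Bool → Prop}
    (skew : ∀ l l', r l l' → r (negLit l') (negLit l)) {l l' : V × Bool}
    (h : Relation.ReflTransGen r l l') : Relation.ReflTransGen r (negLit l') (negLit l) := by
  induction h with
  | refl => exact .refl
  | tail _ hbc ih => exact .head (skew _ _ hbc) ih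

/-- If no literal is equivalent to its negation, a skew-symmetric implication relation
admits an assignment whose set of true literals is closed under implication. -/
theorem exists_closed_assignment [Finite V] (r : V × Bool → V × Bool → Prop)
    (skew : ∀ l l', r l l' → r (negLit l') (negLit l))
    (h : ∀ x, ¬ (Relation.ReflTransGen r x (negLit x) ∧ Relation.ReflTransGen r (negLit x) x)) :
    ∃ a : V → Bool, ∀ l l', r l l' → a l.1 = l.2 → a l'.1 = l'.2 := by
  classical
  -- Consistent sets of literals closed under implication; a maximal one turns out to contain a
  -- literal of every variable.
  let F : Set (Set (V × Bool)) :=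
    {S | (∀ l ∈ S, negLit l ∉ S) ∧ ∀ l l', r l l' → l ∈ S → l' ∈ S}
  obtain ⟨S, hS⟩ : ∃ S, Maximal (· ∈ F) S :=
    (Set.toFinite F).exists_maximal ⟨∅, by simp [F]⟩
  have closed : ∀ l l', Relation.ReflTransGen r l l' → l ∈ S → l' ∈ S := by
    intro l l' hl hlS
    induction hl with
    | refl => exact hlS
    | tail _ hbc ih => exact hS.prop.2 _ _ hbc ih
  -- Adding all consequences of `y` keeps the set consistent: by skew symmetry any clash would give
  -- `y → ¬y` or put `¬y` into `S`.
  have extend : ∀ y, ¬ Relation.ReflTransGen r y (negLit y) → negLit y ∉ S → y ∈ S := by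
    intro y hy hyS
    have hmem : S ∪ {l | Relation.ReflTransGen r y l} ∈ F := by
      refine ⟨?_, ?_⟩
      · rintro l (hl | hl) (hl' | hl')
        · exact hS.prop.1 l hl hl'
        · have := reflTransGen_negLit skew hl'
          rw [negLit_negLit] at this
          exact hyS (closed _ _ this hl)
        · exact hyS (closed _ _ (reflTransGen_negLit skew hl) hl')
        · have := reflTransGen_negLit skew hl'
          rw [negLit_negLit] at this
          exact hy (Relation.ReflTransGen.trans hl this)
      · rintro l l' hll' (hl | hl)
        · exact Or.inl (hS.prop.2 _ _ hll' hl)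
        · exact Or.inr (Relation.ReflTransGen.tail hl hll')
    exact hS.le_of_ge hmem Set.subset_union_left (Or.inr Relation.ReflTransGen.refl)
  have total : ∀ y, y ∈ S ∨ negLit y ∈ S := by
    intro y
    by_contra! hc
    by_cases h1 : Relation.ReflTransGen r y (negLit y)
    · refine hc.2 (extend (negLit y) ?_ (by simpa using hc.1))
      rw [negLit_negLit]
      exact fun h2 => h y ⟨h1, h2⟩
    · exact hc.1 (extend y h1 hc.2)
  have key : ∀ l : V × Bool, decide ((l.1, true) ∈ S) = l.2 ↔ l ∈ S := by
    rintro ⟨v, b⟩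
    have h1 := total (v, true)
    have h2 := hS.prop.1 (v, true)
    simp only [negLit, Bool.not_true] at h1 h2
    cases b
    · simp only [decide_eq_false_iff_not]
      tauto
    · simp
  exact ⟨fun v => decide ((v, true) ∈ S), fun l l' hll' hl =>
    (key l').2 (hS.prop.2 _ _ hll' ((key l).1 hl))⟩

/-- A walk that leaves `x` for good before reaching another point. -/
theorem transGen_avoiding {α : Type*} {r : α → α → Prop} {x y : α}
    (h : Relation.ReflTransGen r x y) (hy : y ≠ x) :
    Relation.TransGen (fun l l' => r l l' ∧ l' ≠ x) x y := by
  induction h with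
  | refl => exact absurd rfl hy
  | @tail b c _ hbc ih =>
    by_cases hb : b = x
    · subst hb
      exact .single ⟨hbc, hy⟩
    · exact .tail (ih hb) ⟨hbc, hy⟩

end Implication

/-! ### Bicycles -/

section Bicycle

variable {X V : Type*}

/-- The points of a list of pairs, in order. -/
def points : List (X × X) → List X
  | [] => []
  | p :: L => p.1 :: p.2 :: points L

/-- The pairs `(u, a₁), (b₁, a₂), …, (bₖ, v)` joining the links `(a₁, b₁), …, (aₖ, bₖ)`. -/
def joints : X → List (X × X) → X → List (X × X)
  | u, [], v => [(u, v)]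
  | u, p :: L, v => (u, p.1) :: joints p.2 L v

theorem length_joints (u : X) (L : List (X × X)) (v : X) :
    (joints u L v).length = L.length + 1 := by
  induction L generalizing u with
  | nil => rfl
  | cons p L ih => simp [joints, ih]

theorem points_joints (u : X) (L : List (X × X)) (v : X) :
    points (joints u L v) = u :: (points L ++ [v]) := by
  induction L generalizing u with
  | nil => rfl
  | cons p L ih => simp [joints, points, ih]

theorem points_append (L L' : List (X × X)) : points (L ++ L') = points L ++ points L' := by
  induction L with
  | nil => rfl
  | cons p L ih => simp [points, ih]

theorem mem_points {L : List (X × X)} {x : X} :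
    x ∈ points L ↔ ∃ p ∈ L, x = p.1 ∨ x = p.2 := by
  induction L with
  | nil => simp [points]
  | cons p L ih => simp [points, ih, or_assoc]

theorem fst_ne_snd_of_nodup {p q : X × X} {L : List (X × X)} (hn : (points (p :: L)).Nodup)
    (hq : q ∈ p :: L) : p.1 ≠ q.2 := by
  intro h
  refine (List.nodup_cons.1 hn).1 ?_
  rcases List.mem_cons.1 hq with rfl | hq
  · simp [h]
  · exact List.mem_cons_of_mem _ (h ▸ mem_points.2 ⟨q, hq, Or.inr rfl⟩)

/-- Used to truncate a long path: the first point of the next link becomes the new right end. -/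
theorem joints_subset_of_append (u : X) (L L' : List (X × X)) (p : X × X) (v : X) :
    joints u L p.1 ⊆ joints u (L ++ p :: L') v := by
  induction L generalizing u with
  | nil => simp [joints]
  | cons q L ih =>
    simp only [joints, List.cons_append]
    exact List.cons_subset_cons _ (ih _)

/-- `L` is a path of implications through distinct variables: consecutive links are joined
by the pairing `f`, and each link consists of two opposite literals of one variable. -/
structure IsPath (var : X → V) (f : X → X) (σ : X → Bool) (L : List (X × X)) : Prop where
  chain : L.IsChain fun p q => f p.2 = q.1
  link : ∀ p ∈ L, var p.1 = var p.2 ∧ σ p.1 ≠ σ p.2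
  nodup : (L.map fun p => var p.1).Nodup

/-- The path `L` extended by `u` and `v` at its ends is an obstruction to satisfiability:
`u` and `v` are further clones of variables on the path. -/
structure IsBicycle (var : X → V) (f : X → X) (σ : X → Bool) (u : X) (L : List (X × X))
    (v : X) : Prop where
  joint : ∀ p ∈ joints u L v, f p.1 = p.2
  link : ∀ p ∈ L, var p.1 = var p.2 ∧ σ p.1 ≠ σ p.2
  nodup : (u :: (points L ++ [v])).Nodup
  left : var u ∈ L.map fun p => var p.1
  right : var v ∈ L.map fun p => var p.1

variable {var : X → V} {f : X → X} {σ : X → Bool}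

theorem IsPath.nodup_points {L : List (X × X)} (h : IsPath var f σ L) : (points L).Nodup := by
  obtain ⟨-, hl, hn⟩ := h
  induction L with
  | nil => simp [points]
  | cons p L ih =>
    simp only [List.map_cons, List.nodup_cons, List.mem_map, not_exists, not_and] at hn
    have hp := hl p (by simp)
    have hL : ∀ q ∈ L, var q.1 = var q.2 ∧ σ q.1 ≠ σ q.2 := fun q hq => hl q (by simp [hq])
    have hx : ∀ x, var x = var p.1 → x ∉ points L := by
      intro x hx hmem
      obtain ⟨q, hq, rfl | rfl⟩ := mem_points.1 hmem
      · exact hn.1 q hq hx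
      · exact hn.1 q hq ((hL q hq).1.trans hx)
    simp only [points, List.nodup_cons, List.mem_cons, not_or]
    exact ⟨⟨fun h => hp.2 (congrArg σ h), hx _ rfl⟩, hx _ hp.1.symm, ih hL hn.2⟩

/-- Contraposition: a path of implications can be read backwards, so it may be extended at either
end. -/
theorem IsPath.reverse (hf : Function.Involutive f) {L : List (X × X)} (h : IsPath var f σ L) :
    IsPath var f σ (L.map Prod.swap).reverse := by
  refine ⟨?_, ?_, ?_⟩
  · rw [List.isChain_reverse, List.isChain_map]
    refine h.chain.imp ?_
    intro p q hpq
    simp [Prod.swap, ← hpq, hf _]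
  · intro p hp
    simp only [List.mem_reverse, List.mem_map] at hp
    obtain ⟨q, hq, rfl⟩ := hp
    exact ⟨(h.link q hq).1.symm, (h.link q hq).2.symm⟩
  · rw [List.map_reverse, List.nodup_reverse, List.map_map]
    have : L.map ((fun p => var p.1) ∘ Prod.swap) = L.map fun p => var p.1 :=
      List.map_congr_left fun p hp => (h.link p hp).1.symm
    rw [this]
    exact h.nodup

theorem mem_vars_reverse {L : List (X × X)} (h : ∀ p ∈ L, var p.1 = var p.2) (w : V) :
    w ∈ ((L.map Prod.swap).reverse.map fun p => var p.1) ↔ w ∈ L.map fun p => var p.1 := by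
  rw [List.map_reverse, List.mem_reverse, List.map_map]
  have : L.map ((fun p => var p.1) ∘ Prod.swap) = L.map fun p => var p.1 :=
    List.map_congr_left fun p hp => (h p hp).symm
  rw [this]

/-- The implications `¬ c → f c` of the clauses `{c, f c}`. -/
def Implies (var : X → V) (f : X → X) (σ : X → Bool) (l l' : V × Bool) : Prop :=
  ∃ c, (var c, !σ c) = l ∧ (var (f c), σ (f c)) = l'

theorem Implies.skew (hf : Function.Involutive f) (l l' : V × Bool)
    (h : Implies var f σ l l') : Implies var f σ (negLit l') (negLit l) := by
  obtain ⟨c, rfl, rfl⟩ := h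
  exact ⟨f c, rfl, by simp [negLit, hf c]⟩

/-- Follow the walk towards `y`, prepending a link for each new variable, and stop once the partner
of the first point lies on a variable of the path; this happens at `y` at the latest. The invariant
`Q` and the final alternative serve to show later that the two ends of a bicycle are not matched to
each other. -/
theorem IsPath.exists_extension (hf : Function.Involutive f) (Q : V × Bool → Prop)
    {l y : V × Bool}
    (hly : Relation.ReflTransGen (fun l l' => Implies var f σ l l' ∧ Q l') l y)
    (p : X × X) (L : List (X × X)) (hL : IsPath var f σ (p :: L))
    (hl : (var (f p.1), σ (f p.1)) = l) (hQ : Q l)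
    (hy : y.1 ∈ (p :: L).map fun q => var q.1) :
    ∃ p' L', IsPath var f σ (p' :: L') ∧ (p :: L) <:+ (p' :: L') ∧
      var (f p'.1) ∈ ((p' :: L').map fun q => var q.1) ∧ Q (var (f p'.1), σ (f p'.1)) ∧
      (p' = p ∨ var p'.1 ∉ (p :: L).map fun q => var q.1) := by
  induction hly using Relation.ReflTransGen.head_induction_on generalizing p L with
  | refl =>
    subst hl
    exact ⟨p, L, hL, List.suffix_refl _, hy, hQ, Or.inl rfl⟩
  | @head l l' hll' _ ih =>
    by_cases hmem : var (f p.1) ∈ (p :: L).map fun q => var q.1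
    · subst hl
      exact ⟨p, L, hL, List.suffix_refl _, hmem, hQ, Or.inl rfl⟩
    obtain ⟨⟨c, hc, hc'⟩, hQ'⟩ := hll'
    rw [← hl, Prod.mk.injEq] at hc
    have hnew : IsPath var f σ ((c, f p.1) :: p :: L) := by
      refine ⟨?_, ?_, ?_⟩
      · exact List.isChain_cons_cons.2 ⟨hf _, hL.chain⟩
      · intro q hq
        rcases List.mem_cons.1 hq with rfl | hq
        · exact ⟨hc.1, fun h => by
            have e := hc.2
            rw [show σ c = σ (f p.1) from h] at e
            simp at e⟩
        · exact hL.link q hq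
      · rw [List.map_cons, List.nodup_cons]
        exact ⟨by simpa only [hc.1] using hmem, hL.nodup⟩
    obtain ⟨p', L', h1, h2, h3, h4, h5⟩ := ih (c, f p.1) (p :: L) hnew hc' hQ'
      (List.mem_cons_of_mem _ hy)
    refine ⟨p', L', h1, (List.suffix_cons _ _).trans h2, h3, h4, Or.inr ?_⟩
    rcases h5 with rfl | h5
    · simpa only [hc.1] using hmem
    · exact fun h => h5 (List.mem_cons_of_mem _ h)

/-- Joints match the interior points of a path among themselves, so the partner of an end point
cannot be an interior point. -/
theorem IsPath.involution_interior (hf : Function.Involutive f) (p : X × X) (L : List (X × X))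
    (q : X × X) (hq : (p :: L).getLast? = some q) (hL : (p :: L).IsChain fun p q => f p.2 = q.1)
    (hn : (points (p :: L)).Nodup) (z : X) (hz : z ∈ points (p :: L)) :
    z = p.1 ∨ z = q.2 ∨ (f z ∈ points (p :: L) ∧ f z ≠ p.1 ∧ f z ≠ q.2) := by
  induction L generalizing p with
  | nil =>
    simp at hq
    subst hq
    simp only [points, List.mem_cons, List.not_mem_nil, or_false] at hz
    exact hz.imp_right Or.inl
  | cons p' L ih =>
    rw [List.isChain_cons_cons] at hL
    have hq' : (p' :: L).getLast? = some q := by simpa using hq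
    have hqm : q.2 ∈ points (p' :: L) := mem_points.2 ⟨q, List.mem_of_getLast? hq', Or.inr rfl⟩
    have hpts : points (p :: p' :: L) = p.1 :: p.2 :: points (p' :: L) := rfl
    rw [hpts] at hn hz ⊢
    simp only [List.nodup_cons, List.mem_cons, not_or] at hn
    obtain ⟨⟨hn1, hn2⟩, hn3, hn4⟩ := hn
    have hp'm : p'.1 ∈ points (p' :: L) := by simp [points]
    have hp'q : p'.1 ≠ q.2 := fst_ne_snd_of_nodup hn4 (List.mem_of_getLast? hq')
    simp only [List.mem_cons] at hz
    rcases hz with rfl | rfl | hz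
    · exact Or.inl rfl
    · right; right
      rw [hL.1]
      exact ⟨by simp [hp'm], fun h => hn2 (h ▸ hp'm), hp'q⟩
    · rcases ih p' hq' hL.2 hn4 hz with rfl | h | ⟨h1, h2, h3⟩
      · right; right
        have : f p'.1 = p.2 := by rw [← hL.1, hf]
        rw [this]
        exact ⟨by simp, fun h => hn1 h.symm, fun h => hn3 (h ▸ hqm)⟩
      · exact Or.inr (Or.inl h)
      · right; right
        exact ⟨by simp [h1], fun h => hn2 (h ▸ h1), h3⟩

theorem joints_of_isChain (u : X) (p : X × X) (L : List (X × X)) (q : X × X) (v : X)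
    (hq : (p :: L).getLast? = some q) (hL : (p :: L).IsChain fun p q => f p.2 = q.1)
    (hu : f u = p.1) (hv : f q.2 = v) : ∀ s ∈ joints u (p :: L) v, f s.1 = s.2 := by
  induction L generalizing p u with
  | nil =>
    simp at hq
    subst hq
    simp [joints, hu, hv]
  | cons p' L ih =>
    rw [List.isChain_cons_cons] at hL
    intro s hs
    rw [joints, List.mem_cons] at hs
    rcases hs with rfl | hs
    · exact hu
    · exact ih p.2 p' (by simpa using hq) hL.2 hL.1 s hs

/-- The walks `x → ¬x` and `¬x → x` leave the variable of `x` through clones `c` and `c'` of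
opposite polarity. Start from the single link `(c, c')`, extend it along the first walk until it
runs into itself, reverse it, and extend it along the second walk. -/
theorem exists_isBicycle (hf : Function.Involutive f) (hf' : ∀ x, f x ≠ x) {x : V × Bool}
    (h1 : Relation.ReflTransGen (Implies var f σ) x (negLit x))
    (h2 : Relation.ReflTransGen (Implies var f σ) (negLit x) x) :
    ∃ u L v, IsBicycle var f σ u L v := by
  obtain ⟨l, ⟨⟨c, hc, hcl⟩, hlx⟩, hl⟩ :=
    Relation.TransGen.head'_iff.1 (transGen_avoiding h1 (negLit_ne x))
  obtain ⟨l', ⟨⟨c', hc', hcl'⟩, -⟩, hl'⟩ :=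
    Relation.TransGen.head'_iff.1 (transGen_avoiding h2 (negLit_ne x).symm)
  have hcx : var c = x.1 := congrArg Prod.fst hc
  have hcx' : var c' = x.1 := congrArg Prod.fst hc'
  have hlit : (var c', σ c') = x := by
    have := congrArg negLit hc'
    simpa [negLit] using this
  have hs : σ c ≠ σ c' := by
    intro h
    have e : (!σ c) = σ c' := (congrArg Prod.snd hc).trans (congrArg Prod.snd hlit).symm
    simp [h] at e
  have start : IsPath var f σ [(c, c')] := by
    refine ⟨by simp, ?_, by simp⟩
    intro p hp
    obtain rfl := List.mem_singleton.1 hp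
    exact ⟨hcx.trans hcx'.symm, hs⟩
  obtain ⟨p₁, L₁, hP₁, hsuf₁, hmem₁, hQ₁, -⟩ := start.exists_extension hf (fun l => l ≠ x) hl
    (c, c') [] hcl hlx (by simp [hcx])
  have hlast : (p₁ :: L₁).getLast? = some (c, c') := by
    obtain ⟨t, ht⟩ := hsuf₁
    rw [← ht]; simp
  have hrev := hP₁.reverse hf
  have hhead : ∃ L₂, ((p₁ :: L₁).map Prod.swap).reverse = (c', c) :: L₂ := by
    obtain ⟨t, ht⟩ := hsuf₁
    rw [← ht]; simp
  obtain ⟨L₂, hL₂⟩ := hhead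
  have hlast₂ : ((c', c) :: L₂).getLast? = some p₁.swap := by
    rw [← hL₂]; simp
  have hvars : ∀ w, w ∈ (((c', c) :: L₂).map fun p => var p.1) ↔
      w ∈ ((p₁ :: L₁).map fun p => var p.1) := by
    intro w
    rw [← hL₂]
    exact mem_vars_reverse (fun p hp => (hP₁.link p hp).1) w
  rw [hL₂] at hrev
  obtain ⟨p₃, L₃, hP₃, hsuf₃, hmem₃, -, hhd⟩ := hrev.exists_extension hf (fun _ => True)
    (Relation.ReflTransGen.mono (fun _ _ h => ⟨h.1, trivial⟩) _ _ hl') (c', c) L₂ hcl' trivial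
    (by simp [hcx'])
  have hlast₃ : (p₃ :: L₃).getLast? = some p₁.swap := by
    obtain ⟨t, ht⟩ := hsuf₃
    rw [← ht, List.getLast?_append, hlast₂]; rfl
  have hsub : ∀ w, w ∈ ((p₁ :: L₁).map fun p => var p.1) →
      w ∈ ((p₃ :: L₃).map fun p => var p.1) := fun w hw =>
    (List.map_subset _ hsuf₃.subset) ((hvars w).2 hw)
  -- The ends are not matched to each other. If the second extension is empty, `p₃.1 = c'` carries
  -- the literal `x`, which the first walk avoids; otherwise `p₃.1` has a variable new to the first
  -- path, while `f p₁.1` lies on a variable of it.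
  have hne : f p₁.1 ≠ p₃.1 := by
    intro h
    rcases hhd with rfl | hhd
    · rw [h] at hQ₁
      exact hQ₁ hlit
    · rw [← h] at hhd
      exact hhd ((hvars _).2 hmem₁)
  have hpts := hP₃.nodup_points
  have hint := IsPath.involution_interior hf p₃ L₃ _ hlast₃ hP₃.chain hpts
  have hhm : p₃.1 ∈ points (p₃ :: L₃) := by simp [points]
  have hlm : p₁.1 ∈ points (p₃ :: L₃) :=
    mem_points.2 ⟨_, List.mem_of_getLast? hlast₃, Or.inr rfl⟩
  have hends : p₃.1 ≠ p₁.1 := fst_ne_snd_of_nodup hpts (List.mem_of_getLast? hlast₃)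
  refine ⟨f p₃.1, p₃ :: L₃, f p₁.1, ?_, hP₃.link, ?_, hmem₃, hsub _ hmem₁⟩
  · exact joints_of_isChain _ _ _ _ _ hlast₃ hP₃.chain (hf _) rfl
  · have hu : f p₃.1 ∉ points (p₃ :: L₃) := by
      intro h
      rcases hint _ h with h | h | h
      · exact hf' _ h
      · exact hne (by rw [← hf p₃.1, h]; rfl)
      · exact h.2.1 (hf _)
    have hv : f p₁.1 ∉ points (p₃ :: L₃) := by
      intro h
      rcases hint _ h with h | h | h
      · exact hne h
      · exact hf' _ h
      · exact h.2.2 (hf _)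
    rw [List.nodup_cons, List.nodup_append]
    refine ⟨?_, hpts, by simp, ?_⟩
    · simp only [List.mem_append, List.mem_singleton, not_or]
      exact ⟨hu, fun h => hends (hf.injective h)⟩
    · rintro a ha b hb rfl
      rw [List.mem_singleton] at hb
      exact hv (hb ▸ ha)

end Bicycle

theorem exists_isBicycle_of_not_satisfiable {n : ℕ} {d : Fin n → ℕ} (o : Outcome d)
    (h : ¬ (toCNF d o).Satisfiable) :
    ∃ u L v, IsBicycle (fun c : Clone d => c.1) o.1.1 o.2 u L v := by
  by_contra hno
  apply h
  obtain ⟨a, ha⟩ := exists_closed_assignment (Implies (fun c : Clone d => c.1) o.1.1 o.2)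
    (Implies.skew o.1.2.1) (fun x hx => hno (exists_isBicycle o.1.2.1 o.1.2.2 hx.1 hx.2))
  refine ⟨a, ?_⟩
  intro C hC
  obtain ⟨e, he, rfl⟩ := Multiset.mem_map.1 hC
  obtain ⟨c, -, rfl⟩ := Finset.mem_image.1 he
  by_cases hc : a c.1 = o.2 c
  · exact ⟨(c.1, o.2 c), by simp, hc⟩
  · refine ⟨((o.1.1 c).1, o.2 (o.1.1 c)), by simp, ?_⟩
    refine ha (c.1, !o.2 c) _ ⟨c, rfl, rfl⟩ ?_
    cases h1 : a c.1 <;> cases h2 : o.2 c <;> simp_all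

/-! ### Counting pairings and polarities -/

section Counting

theorem length_points {X : Type*} (L : List (X × X)) : (points L).length = 2 * L.length := by
  induction L with
  | nil => rfl
  | cons p L ih => simp [points, ih]; ring

open Classical in
-- A switching argument: conjugating `f` by the transposition of `p.2` with any `y` outside `p.1`
-- and the other prescribed pairs keeps those pairs and rematches `p.1` to `y`. Both `y` and `f` can
-- be recovered, so each prescribed pair costs a factor `q`.
theorem card_pairing_mul_pow_le {X : Type} [Fintype X] (T : List (X × X))
    (hT : (points T).Nodup) (q : ℕ) (hq : q + 2 * T.length ≤ Fintype.card X) :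
    (Finset.univ.filter fun f : Pairing X => ∀ p ∈ T, f.1 p.1 = p.2).card * q ^ T.length ≤
      Fintype.card (Pairing X) := by
  induction T with
  | nil => simp
  | cons p T ih =>
    have hp := hT
    simp only [points, List.nodup_cons, List.mem_cons, not_or] at hp
    obtain ⟨⟨hp12, hp1⟩, hp2, hT'⟩ := hp
    rw [List.length_cons] at hq
    refine le_trans ?_ (ih hT' (by omega))
    rw [List.length_cons, pow_succ', ← mul_assoc]
    refine Nat.mul_le_mul_right _ ?_
    set Y : Finset X := Finset.univ \ (insert p.1 (points T).toFinset) with hY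
    have hYc : q ≤ Y.card := by
      have h1 : (insert p.1 (points T).toFinset).card ≤ 2 * T.length + 1 := by
        refine (Finset.card_insert_le _ _).trans ?_
        have := (points T).toFinset_card_le
        rw [length_points] at this
        omega
      have h2 := Finset.le_card_sdiff (insert p.1 (points T).toFinset) Finset.univ
      rw [Finset.card_univ, ← hY] at h2
      omega
    refine (Nat.mul_le_mul_left _ hYc).trans ?_
    rw [← Finset.card_product]
    let conj : Pairing X × X → Pairing X := fun z =>
      ⟨fun x => Equiv.swap z.2 p.2 (z.1.1 (Equiv.swap z.2 p.2 x)), by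
        refine ⟨fun x => ?_, fun x h => ?_⟩
        · simp only [Equiv.swap_apply_self, z.1.2.1 _]
        · refine z.1.2.2 (Equiv.swap z.2 p.2 x) ?_
          have := congrArg (Equiv.swap z.2 p.2) h
          simpa using this⟩
    refine Finset.card_le_card_of_injOn conj ?_ ?_
    · rintro ⟨f, y⟩ hz
      simp only [Finset.coe_product, Set.mem_prod, Finset.mem_coe, Finset.mem_filter,
        Finset.mem_univ, true_and, hY, Finset.mem_sdiff, Finset.mem_insert, List.mem_toFinset,
        not_or, List.mem_cons, forall_eq_or_imp] at hz ⊢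
      intro t ht
      have h1 : t.1 ∈ points T := mem_points.2 ⟨t, ht, Or.inl rfl⟩
      have h2 : t.2 ∈ points T := mem_points.2 ⟨t, ht, Or.inr rfl⟩
      have e1 : Equiv.swap y p.2 t.1 = t.1 :=
        Equiv.swap_apply_of_ne_of_ne (fun h => hz.2.2 (h ▸ h1)) (fun h => hp2 (h ▸ h1))
      have e2 : Equiv.swap y p.2 t.2 = t.2 :=
        Equiv.swap_apply_of_ne_of_ne (fun h => hz.2.2 (h ▸ h2)) (fun h => hp2 (h ▸ h2))
      simp only [conj, e1, hz.1.2 t ht, e2]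
    · rintro ⟨f, y⟩ hz ⟨f', y'⟩ hz' heq
      simp only [Finset.coe_product, Set.mem_prod, Finset.mem_coe, Finset.mem_filter,
        Finset.mem_univ, true_and, hY, Finset.mem_sdiff, Finset.mem_insert, List.mem_toFinset,
        not_or, List.mem_cons, forall_eq_or_imp] at hz hz'
      have key : ∀ x, Equiv.swap y p.2 (f.1 (Equiv.swap y p.2 x)) =
          Equiv.swap y' p.2 (f'.1 (Equiv.swap y' p.2 x)) := fun x =>
        congrFun (congrArg Subtype.val heq) x
      have hyy : y = y' := by
        have := key p.1
        rw [Equiv.swap_apply_of_ne_of_ne (Ne.symm hz.2.1) hp12,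
          Equiv.swap_apply_of_ne_of_ne (Ne.symm hz'.2.1) hp12, hz.1.1, hz'.1.1,
          Equiv.swap_apply_right, Equiv.swap_apply_right] at this
        exact this
      subst hyy
      refine Prod.ext (Subtype.ext (funext fun x => ?_)) rfl
      have := key (Equiv.swap y p.2 x)
      simpa using this

open Classical in
-- Flipping `p.1` or not gives two outcomes per admissible polarity; the original value there is
-- forced by that of `p.2`.
theorem card_polarity_mul_pow_le {X : Type} [Fintype X] (L : List (X × X))
    (hL : (points L).Nodup) :
    (Finset.univ.filter fun σ : X → Bool => ∀ p ∈ L, σ p.1 ≠ σ p.2).card * 2 ^ L.length ≤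
      Fintype.card (X → Bool) := by
  induction L with
  | nil => simp
  | cons p L ih =>
    have hp := hL
    simp only [points, List.nodup_cons, List.mem_cons, not_or] at hp
    obtain ⟨⟨hp12, hp1⟩, hp2, hL'⟩ := hp
    refine le_trans ?_ (ih hL')
    rw [List.length_cons, pow_succ', ← mul_assoc]
    refine Nat.mul_le_mul_right _ ?_
    have h2 : (2 : ℕ) = (Finset.univ : Finset Bool).card := rfl
    rw [h2, ← Finset.card_product]
    refine Finset.card_le_card_of_injOn
      (fun z => Function.update z.1 p.1 (z.2 ^^ z.1 p.1)) ?_ ?_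
    · rintro ⟨σ, e⟩ hz
      simp only [Finset.coe_product, Set.mem_prod, Finset.mem_coe, Finset.mem_filter,
        Finset.mem_univ, true_and, and_true, List.mem_cons, forall_eq_or_imp] at hz ⊢
      intro t ht
      rw [Function.update_of_ne fun h => hp1 (mem_points.2 ⟨t, ht, Or.inl h.symm⟩),
        Function.update_of_ne fun h => hp1 (mem_points.2 ⟨t, ht, Or.inr h.symm⟩)]
      exact hz.2 t ht
    · rintro ⟨σ, e⟩ hz ⟨σ', e'⟩ hz' heq
      simp only [Finset.coe_product, Set.mem_prod, Finset.mem_coe, Finset.mem_filter,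
        Finset.mem_univ, true_and, and_true, List.mem_cons, forall_eq_or_imp] at hz hz'
      have hne : ∀ x, x ≠ p.1 → σ x = σ' x := fun x hx => by
        have := congrFun heq x
        simpa only [Function.update_of_ne hx] using this
      have h1 := congrFun heq p.1
      simp only [Function.update_self] at h1
      have h2 := hne p.2 (Ne.symm hp12)
      have h3 := hz.1
      have h4 := hz'.1
      have h5 : σ p.1 = σ' p.1 := by
        revert h3 h4
        rw [h2]
        cases σ p.1 <;> cases σ' p.1 <;> cases σ' p.2 <;> simp
      refine Prod.ext (funext fun x => ?_) ?_
      · by_cases hx : x = p.1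
        · rw [hx]; exact h5
        · exact hne x hx
      · rw [h5] at h1
        simpa using h1

end Counting

/-! ### The first moment bound -/

theorem IsBicycle.fst_ne_snd {X V : Type*} {var : X → V} {f : X → X} {σ : X → Bool} {u v : X}
    {L : List (X × X)} (h : IsBicycle var f σ u L v) : ∀ p ∈ L, var p.1 = var p.2 ∧ p.1 ≠ p.2 :=
  fun p hp => ⟨(h.link p hp).1, fun e => (h.link p hp).2 (congrArg σ e)⟩

section FirstMoment

variable {X V : Type} [Fintype X]

/-- All joints of the path `L` with ends `u` and `v` are present, with alternating
polarities. -/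
def Joined (o : Pairing X × (X → Bool)) (u : X) (L : List (X × X)) (v : X) : Prop :=
  (∀ p ∈ joints u L v, o.1.1 p.1 = p.2) ∧ (∀ p ∈ L, o.2 p.1 ≠ o.2 p.2) ∧
    (u :: (points L ++ [v])).Nodup

open Classical in
theorem card_joined_mul_le (u : X) (L : List (X × X)) (v : X) (q : ℕ)
    (hq : q + 2 * (L.length + 1) ≤ Fintype.card X) :
    (Finset.univ.filter fun o : Pairing X × (X → Bool) => Joined o u L v).card *
      (q ^ (L.length + 1) * 2 ^ L.length) ≤ Fintype.card (Pairing X × (X → Bool)) := by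
  by_cases hn : (u :: (points L ++ [v])).Nodup
  · have hT : (points (joints u L v)).Nodup := by rwa [points_joints]
    have hL : (points L).Nodup := (List.nodup_append.1 (List.nodup_cons.1 hn).2).1
    have h1 := card_pairing_mul_pow_le (joints u L v) hT q (by rwa [length_joints])
    have h2 := card_polarity_mul_pow_le L hL
    rw [length_joints] at h1
    have hsub : (Finset.univ.filter fun o : Pairing X × (X → Bool) => Joined o u L v) ⊆
        (Finset.univ.filter fun f : Pairing X => ∀ p ∈ joints u L v, f.1 p.1 = p.2) ×ˢ
        (Finset.univ.filter fun σ : X → Bool => ∀ p ∈ L, σ p.1 ≠ σ p.2) := by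
      intro o ho
      have ho' := (Finset.mem_filter.1 ho).2
      exact Finset.mem_product.2 ⟨Finset.mem_filter.2 ⟨Finset.mem_univ _, ho'.1⟩,
        Finset.mem_filter.2 ⟨Finset.mem_univ _, ho'.2.1⟩⟩
    have h3 := Finset.card_le_card hsub
    rw [Finset.card_product] at h3
    rw [Fintype.card_prod]
    refine (Nat.mul_le_mul_right _ h3).trans ?_
    rw [mul_mul_mul_comm]
    exact Nat.mul_le_mul h1 h2
  · have : (Finset.univ.filter fun o : Pairing X × (X → Bool) => Joined o u L v) = ∅ :=
      Finset.filter_eq_empty_iff.2 fun o _ h => hn h.2.2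
    rw [this, Finset.card_empty, zero_mul]
    exact Nat.zero_le _

open Classical in
-- Union bound over `Λ ^ k` paths and `m ^ 2` pairs of ends. The set `U L` of allowed ends is left
-- open to cover both short bicycles (ends on the path) and truncated ones (arbitrary ends).
theorem card_exists_joined_le (S : Set (X × X)) (k Λ : ℕ) (hΛ : Nat.card S ≤ Λ)
    (U : List (X × X) → Finset X) (m : ℕ)
    (hU : ∀ L, L.length = k → (U L).card ≤ m) (q : ℕ) (hq0 : 0 < q)
    (hq : q + 2 * (k + 1) ≤ Fintype.card X) :
    ((Finset.univ.filter fun o : Pairing X × (X → Bool) => ∃ L : List (X × X), L.length = k ∧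
      (∀ p ∈ L, p ∈ S) ∧ ∃ u ∈ U L, ∃ v ∈ U L, Joined o u L v).card : ℝ) ≤
      Fintype.card (Pairing X × (X → Bool)) * ((m : ℝ) ^ 2 / q * ((Λ : ℝ) / (2 * q)) ^ k) := by
  set N := Fintype.card (Pairing X × (X → Bool)) / (q ^ (k + 1) * 2 ^ k) with hN
  set F : Finset (List (X × X)) :=
    (Finset.univ : Finset (Fin k → S)).image fun g => List.ofFn fun i => (g i).1 with hF
  have hFcard : F.card ≤ Λ ^ k := by
    refine Finset.card_image_le.trans ?_
    rw [Finset.card_univ, Fintype.card_fun, Fintype.card_fin, ← Nat.card_eq_fintype_card]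
    exact Nat.pow_le_pow_left hΛ k
  have hFlen : ∀ L ∈ F, L.length = k := by
    intro L hL
    obtain ⟨g, -, rfl⟩ := Finset.mem_image.1 hL
    simp
  have hbound : (Finset.univ.filter fun o : Pairing X × (X → Bool) => ∃ L : List (X × X),
      L.length = k ∧ (∀ p ∈ L, p ∈ S) ∧
      ∃ u ∈ U L, ∃ v ∈ U L, Joined o u L v).card ≤ F.card * (m * m * N) := by
    refine (Finset.card_le_card (t := F.biUnion fun L => (U L ×ˢ U L).biUnion fun z =>
      Finset.univ.filter fun o : Pairing X × (X → Bool) => Joined o z.1 L z.2) ?_).trans ?_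
    · intro o ho
      obtain ⟨-, L, hLk, hL, u, hu, v, hv, h⟩ := Finset.mem_filter.1 ho
      refine Finset.mem_biUnion.2 ⟨L, ?_, Finset.mem_biUnion.2 ⟨(u, v),
        Finset.mem_product.2 ⟨hu, hv⟩, Finset.mem_filter.2 ⟨Finset.mem_univ _, h⟩⟩⟩
      subst hLk
      refine Finset.mem_image.2 ⟨fun i => ⟨L.get i, hL _ (L.get_mem i)⟩, Finset.mem_univ _, ?_⟩
      exact List.ofFn_get L
    · refine Finset.card_biUnion_le_card_mul _ _ _ fun L hL => ?_
      refine (Finset.card_biUnion_le_card_mul _ _ N fun z _ => ?_).trans ?_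
      · have := card_joined_mul_le z.1 L z.2 q (by rw [hFlen L hL]; exact hq)
        rw [hFlen L hL] at this
        exact (Nat.le_div_iff_mul_le (by positivity)).2 this
      · rw [Finset.card_product]
        have := hU L (hFlen L hL)
        gcongr
  have hNr : (N : ℝ) ≤
      (Fintype.card (Pairing X × (X → Bool)) : ℝ) / ((q : ℝ) ^ (k + 1) * 2 ^ k) := by
    refine (Nat.cast_div_le (α := ℝ)).trans_eq ?_
    rw [Nat.cast_mul, Nat.cast_pow, Nat.cast_pow, Nat.cast_ofNat]
  have hFr : (F.card : ℝ) ≤ (Λ : ℝ) ^ k := by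
    rw [← Nat.cast_pow]
    exact Nat.cast_le.2 hFcard
  have hq' : (q : ℝ) ≠ 0 := Nat.cast_ne_zero.2 hq0.ne'
  generalize (Fintype.card (Pairing X × (X → Bool)) : ℝ) = A at hNr ⊢
  calc _ ≤ ((F.card * (m * m * N) : ℕ) : ℝ) := Nat.cast_le.2 hbound
    _ = (F.card : ℝ) * ((m : ℝ) * m * N) := by push_cast; rfl
    _ ≤ (Λ : ℝ) ^ k * ((m : ℝ) * m * (A / ((q : ℝ) ^ (k + 1) * 2 ^ k))) := by
        gcongr
    _ = _ := by
        rw [div_pow, mul_pow, pow_succ]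
        field_simp

open Classical in
theorem card_filter_mem_vars_le (var : X → V) (D : ℕ)
    (hD : ∀ w, Nat.card {c // var c = w} ≤ D) (L : List (X × X)) :
    (Finset.univ.filter fun c : X => var c ∈ L.map fun p => var p.1).card ≤ L.length * D := by
  have hsub : (Finset.univ.filter fun c : X => var c ∈ L.map fun p => var p.1) ⊆
      (L.map fun p => var p.1).toFinset.biUnion fun w => Finset.univ.filter fun c => var c = w := by
    intro c hc
    simpa using hc
  refine (Finset.card_le_card hsub).trans ((Finset.card_biUnion_le_card_mul _ _ D ?_).trans ?_)
  · intro w _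
    have := hD w
    rwa [Nat.card_eq_fintype_card, Fintype.card_subtype] at this
  · refine Nat.mul_le_mul_right _ ?_
    simpa using (L.map fun p => var p.1).toFinset_card_le

/-- Bicycles with at least `K` links are cut to their first `K` links, since `q` stays close to the
number of clones only if few pairs are prescribed. -/
theorem ncard_exists_isBicycle_le (var : X → V) (D Λ : ℕ)
    (hD : ∀ w, Nat.card {c // var c = w} ≤ D)
    (hΛ : Nat.card {p : X × X | var p.1 = var p.2 ∧ p.1 ≠ p.2} ≤ Λ)
    (K q : ℕ) (hq0 : 0 < q) (hq : q + 2 * (K + 1) ≤ Nat.card X) :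
    (Set.ncard {o : Pairing X × (X → Bool) | ∃ u L v, IsBicycle var o.1.1 o.2 u L v} : ℝ) ≤
      Nat.card (Pairing X × (X → Bool)) *
        (∑ k ∈ Finset.range K, ((k * D : ℝ) ^ 2 / q * ((Λ : ℝ) / (2 * q)) ^ k) +
          (Nat.card X : ℝ) ^ 2 / q * ((Λ : ℝ) / (2 * q)) ^ K) := by
  classical
  set S : Set (X × X) := {p : X × X | var p.1 = var p.2 ∧ p.1 ≠ p.2}
  rw [Nat.card_eq_fintype_card (α := X)] at *
  let E : ℕ → (List (X × X) → Finset X) → Finset (Pairing X × (X → Bool)) := fun k U =>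
    Finset.univ.filter fun o : Pairing X × (X → Bool) => ∃ L : List (X × X), L.length = k ∧
      (∀ p ∈ L, p ∈ S) ∧ ∃ u ∈ U L, ∃ v ∈ U L, Joined o u L v
  let U₀ : List (X × X) → Finset X := fun L =>
    Finset.univ.filter fun c : X => var c ∈ L.map fun p => var p.1
  have hsub : {o : Pairing X × (X → Bool) | ∃ u L v, IsBicycle var o.1.1 o.2 u L v} ⊆
      ((((Finset.range K).biUnion fun k => E k U₀) ∪ E K fun _ => Finset.univ : Finset _) :
        Set (Pairing X × (X → Bool))) := by
    rintro o ⟨u, L, v, h⟩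
    rw [Finset.mem_coe, Finset.mem_union]
    by_cases hK : L.length < K
    · left
      refine Finset.mem_biUnion.2 ⟨L.length, Finset.mem_range.2 hK, Finset.mem_filter.2
        ⟨Finset.mem_univ _, L, rfl, h.fst_ne_snd, u, ?_, v, ?_, h.joint,
          fun p hp => (h.link p hp).2, h.nodup⟩⟩
      · exact Finset.mem_filter.2 ⟨Finset.mem_univ _, h.left⟩
      · exact Finset.mem_filter.2 ⟨Finset.mem_univ _, h.right⟩
    · right
      -- The new right end is `v` itself if `L` has exactly `K` links, and otherwise the first point
      -- of the next link.
      obtain ⟨v', hv1, hv2⟩ : ∃ v', joints u (L.take K) v' ⊆ joints u L v ∧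
          (u :: (points (L.take K) ++ [v'])).Sublist (u :: (points L ++ [v])) := by
        have hsplit := List.take_append_drop K L
        rcases hdrop : L.drop K with _ | ⟨p, L'⟩
        · rw [hdrop, List.append_nil] at hsplit
          exact ⟨v, by rw [hsplit]; exact List.Subset.refl _, by rw [hsplit]⟩
        · rw [hdrop] at hsplit
          refine ⟨p.1, ?_, ?_⟩
          · have := joints_subset_of_append u (L.take K) L' p v
            rwa [hsplit] at this
          · have : points L = points (L.take K) ++ points (p :: L') := by
              rw [← points_append, hsplit]
            rw [this, points, List.append_assoc]
            refine List.Sublist.cons_cons _ (List.Sublist.append_left ?_ _)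
            simp
      have hmem : ∀ p ∈ L.take K, p ∈ L := fun p hp => List.mem_of_mem_take hp
      exact Finset.mem_filter.2 ⟨Finset.mem_univ _, L.take K, by
        rw [List.length_take]; omega, fun p hp => h.fst_ne_snd p (hmem p hp), u,
        Finset.mem_univ _, v', Finset.mem_univ _, fun p hp => h.joint p (hv1 hp),
        fun p hp => (h.link p (hmem p hp)).2, h.nodup.sublist hv2⟩
  have h1 := Set.ncard_le_ncard hsub (Finset.finite_toSet _)
  rw [Set.ncard_coe_finset] at h1
  have h2 := (h1.trans (Finset.card_union_le _ _)).trans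
    (Nat.add_le_add_right Finset.card_biUnion_le _)
  have h3 : ∀ k ∈ Finset.range K, ((E k U₀).card : ℝ) ≤
      Fintype.card (Pairing X × (X → Bool)) *
        ((k * D : ℝ) ^ 2 / q * ((Λ : ℝ) / (2 * q)) ^ k) := by
    intro k hk
    rw [Finset.mem_range] at hk
    rw [← Nat.cast_mul]
    exact card_exists_joined_le S k Λ hΛ U₀ (k * D)
      (fun L hL => hL ▸ card_filter_mem_vars_le var D hD L) q hq0 (by omega)
  have h4 : ((E K fun _ => Finset.univ).card : ℝ) ≤ Fintype.card (Pairing X × (X → Bool)) *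
      ((Fintype.card X : ℝ) ^ 2 / q * ((Λ : ℝ) / (2 * q)) ^ K) :=
    card_exists_joined_le S K Λ hΛ (fun _ => Finset.univ) _
      (fun L _ => Finset.card_univ.le) q hq0 hq
  rw [mul_add, Finset.mul_sum, Nat.card_eq_fintype_card]
  refine (Nat.cast_le.2 h2).trans ?_
  rw [Nat.cast_add, Nat.cast_sum]
  exact add_le_add (Finset.sum_le_sum h3) h4

end FirstMoment

/-! ### Fixed degrees -/

section FixedDegrees

variable {n : ℕ} (d : Fin n → ℕ)

theorem card_clone : Nat.card (Clone d) = ∑ i, d i := by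
  simp [Clone]

theorem card_clone_fiber (i : Fin n) : Nat.card {c : Clone d // c.1 = i} = d i := by
  rw [Nat.card_congr (Equiv.sigmaSubtype i), Nat.card_eq_fintype_card, Fintype.card_fin]

theorem card_link_le :
    Nat.card {p : Clone d × Clone d | p.1.1 = p.2.1 ∧ p.1 ≠ p.2} ≤ ∑ i, d i * (d i - 1) := by
  classical
  have h : Nat.card (Σ i : Fin n, Σ a : Fin (d i), {b : Fin (d i) // b ≠ a}) =
      ∑ i, d i * (d i - 1) := by
    simp [Nat.card_eq_fintype_card, Fintype.card_sigma, Fintype.card_subtype_compl]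
  rw [← h]
  refine Nat.card_le_card_of_surjective
    (fun z => ⟨(⟨z.1, z.2.1⟩, ⟨z.1, z.2.2.1⟩), rfl, fun h => z.2.2.2 ?_⟩) ?_
  · simpa using h.symm
  · rintro ⟨⟨⟨i, a⟩, ⟨j, b⟩⟩, hij, hab⟩
    dsimp only at hij
    subst hij
    exact ⟨⟨i, a, b, fun h => hab (by rw [h])⟩, rfl⟩

variable {d}

theorem ncard_not_satisfiable_le (D : ℕ) (hD : ∀ i, d i ≤ D) (K q : ℕ) (hq0 : 0 < q)
    (hq : q + 2 * (K + 1) ≤ ∑ i, d i) :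
    (Set.ncard {o : Outcome d | ¬ (toCNF d o).Satisfiable} : ℝ) ≤
      Nat.card (Outcome d) *
        (∑ k ∈ Finset.range K, ((k * D : ℝ) ^ 2 / q *
            (((∑ i, d i * (d i - 1) : ℕ) : ℝ) / (2 * q)) ^ k) +
          ((∑ i, d i : ℕ) : ℝ) ^ 2 / q *
            (((∑ i, d i * (d i - 1) : ℕ) : ℝ) / (2 * q)) ^ K) := by
  have h1 := ncard_exists_isBicycle_le (fun c : Clone d => c.1) D (∑ i, d i * (d i - 1))
    (fun i => (card_clone_fiber d i).trans_le (hD i)) (card_link_le d) K q hq0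
    (by rwa [card_clone])
  rw [card_clone] at h1
  refine le_trans (Nat.cast_le.2 (Set.ncard_le_ncard ?_ (Set.toFinite _))) h1
  exact fun o ho => exists_isBicycle_of_not_satisfiable o ho

theorem nonempty_pairing {X : Type} [Finite X] (h : Even (Nat.card X)) :
    Nonempty (Pairing X) := by
  obtain ⟨m, hm⟩ := h
  have e : X ≃ Fin m × Bool := by
    refine (Finite.equivFin X).trans (Fintype.equivOfCardEq ?_)
    simp [hm, mul_two]
  exact ⟨⟨fun x => e.symm ((e x).1, !(e x).2), fun x => by simp, fun x h => by
    have := congrArg (fun y => (e y).2) h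
    simp at this⟩⟩

theorem nonempty_outcome (h : Even (∑ i, d i)) : Nonempty (Outcome d) := by
  rw [← card_clone] at h
  obtain ⟨f⟩ := nonempty_pairing h
  exact ⟨(f, fun _ => true)⟩

theorem formulaLaw_apply (s : Set (TwoCNF n)) :
    formulaLaw d s = (Set.ncard {o : Outcome d | toCNF d o ∈ s} : ℝ≥0∞) /
      Nat.card (Outcome d) := by
  classical
  let _ : MeasurableSpace (Outcome d) := ⊤
  rw [formulaLaw, Measure.map_apply measurable_from_top MeasurableSpace.measurableSet_top,
    uniformOn_univ, Measure.count_apply MeasurableSpace.measurableSet_top,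
    Nat.card_eq_fintype_card]
  congr 1
  rw [← Set.Finite.cast_ncard_eq (Set.toFinite _)]
  rfl

theorem isProbabilityMeasure_formulaLaw (h : Even (∑ i, d i)) :
    IsProbabilityMeasure (formulaLaw d) := by
  have := nonempty_outcome h
  let _ : MeasurableSpace (Outcome d) := ⊤
  exact Measure.isProbabilityMeasure_map measurable_from_top.aemeasurable

theorem formulaLaw_not_satisfiable_le (D : ℕ) (hD : ∀ i, d i ≤ D) (K q : ℕ) (hq0 : 0 < q)
    (hq : q + 2 * (K + 1) ≤ ∑ i, d i) (ρ : ℝ)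
    (hρ : ((∑ i, d i * (d i - 1) : ℕ) : ℝ) ≤ ρ * (2 * q)) :
    formulaLaw d {φ | ¬ φ.Satisfiable} ≤ ENNReal.ofReal
      (∑ k ∈ Finset.range K, ((k * D : ℝ) ^ 2 / q * ρ ^ k) +
          ((∑ i, d i : ℕ) : ℝ) ^ 2 / q * ρ ^ K) := by
  have hq' : (0 : ℝ) < q := Nat.cast_pos.2 hq0
  have h1 := ncard_not_satisfiable_le D hD K q hq0 hq
  have h2 : ((∑ i, d i * (d i - 1) : ℕ) : ℝ) / (2 * q) ≤ ρ := by
    rwa [div_le_iff₀ (by positivity)]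
  have h3 : (∑ k ∈ Finset.range K, ((k * D : ℝ) ^ 2 / q *
            (((∑ i, d i * (d i - 1) : ℕ) : ℝ) / (2 * q)) ^ k) +
          ((∑ i, d i : ℕ) : ℝ) ^ 2 / q *
            (((∑ i, d i * (d i - 1) : ℕ) : ℝ) / (2 * q)) ^ K) ≤
      ∑ k ∈ Finset.range K, ((k * D : ℝ) ^ 2 / q * ρ ^ k) +
          ((∑ i, d i : ℕ) : ℝ) ^ 2 / q * ρ ^ K := by
    gcongr
  have h4 := h1.trans (mul_le_mul_of_nonneg_left h3 (Nat.cast_nonneg _))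
  rw [formulaLaw_apply]
  refine ENNReal.div_le_of_le_mul' ?_
  rw [← ENNReal.ofReal_natCast (Nat.card (Outcome d)),
    ← ENNReal.ofReal_mul (Nat.cast_nonneg _), ← ENNReal.ofReal_natCast]
  exact ENNReal.ofReal_le_ofReal h4

end FixedDegrees

/-! ### Independent degrees -/

section Degrees

variable (μ : Measure ℕ) [IsProbabilityMeasure μ]

instance (n : ℕ) : IsProbabilityMeasure (iidDegrees n μ) := by
  unfold iidDegrees; infer_instance

/-- A weak law of large numbers: sums of i.i.d. terms of negative mean are rarely positive. -/
theorem tendsto_iidDegrees_sum_pos (g : ℕ → ℝ) (hg : Integrable g μ) (hneg : ∫ x, g x ∂μ < 0) :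
    Tendsto (fun n => iidDegrees n μ {d | 0 < ∑ i, g (d i)}) atTop (𝓝 0) := by
  obtain ⟨Ω, mΩ, P, X, hXm, hXlaw, hindep, hP⟩ := exists_iid ℕ μ
  have hgm : Measurable g := Measurable.of_discrete
  have hint : Integrable (fun ω => g (X 0 ω)) P := by
    have h := hg
    rw [← (hXlaw 0).map_eq] at h
    exact h.comp_measurable (hXm 0)
  have hmean : ∫ ω, g (X 0 ω) ∂P = ∫ x, g x ∂μ := by
    rw [← (hXlaw 0).map_eq, integral_map (hXm 0).aemeasurable hgm.aestronglyMeasurable]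
  have hlln := strong_law_ae_real (fun i ω => g (X i ω)) hint
    (fun i j hij => (hindep.indepFun hij).comp hgm hgm)
    (fun i => ((hXlaw i).identDistrib (hXlaw 0)).comp hgm)
  have hmeas := tendstoInMeasure_of_tendsto_ae (fun n => by fun_prop) hlln
  rw [tendstoInMeasure_iff_dist] at hmeas
  -- A positive sum forces the empirical mean to deviate from the negative expectation by at least
  -- its absolute value.
  have h0 := hmeas (-∫ x, g x ∂μ) (by linarith)
  have hlaw : ∀ n, iidDegrees n μ = P.map fun ω (i : Fin n) => X i ω := by
    intro n
    have hn : iIndepFun (fun i : Fin n => X i) P := hindep.precomp Fin.val_injective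
    have h := iIndepFun.map_fun_eq_pi_map (f := fun i : Fin n => X i)
      (fun i => (hXm i).aemeasurable) hn
    simp only [(hXlaw _).map_eq] at h
    exact h.symm
  refine tendsto_of_tendsto_of_tendsto_of_le_of_le tendsto_const_nhds h0
    (fun _ => zero_le) fun n => ?_
  rw [hlaw n, Measure.map_apply (by fun_prop) (Set.Countable.measurableSet (Set.to_countable _))]
  refine measure_mono fun ω hω => ?_
  have hω' : 0 < ∑ i : Fin n, g (X i ω) := hω
  rw [Fin.sum_univ_eq_sum_range (fun i => g (X i ω))] at hω'
  change -∫ x, g x ∂μ ≤ dist ((∑ i ∈ Finset.range n, g (X i ω)) / n) (∫ ω, g (X 0 ω) ∂P)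
  rw [hmean, Real.dist_eq]
  refine le_trans ?_ (le_abs_self _)
  have : 0 ≤ (∑ i ∈ Finset.range n, g (X i ω)) / n := by positivity
  linarith

/-- With a finite second moment, the maximum of `n` i.i.d. degrees is `o(√n)`. -/
theorem tendsto_iidDegrees_exists_sq_gt (hsq : ∫⁻ x, (x : ℝ≥0∞) ^ 2 ∂μ ≠ ∞) {ε : ℝ} (hε : 0 < ε) :
    Tendsto (fun n => iidDegrees n μ {d | ∃ i, ε * n < (d i : ℝ) ^ 2}) atTop (𝓝 0) := by
  let A : ℕ → Set ℕ := fun n => {x | ε * n < (x : ℝ) ^ 2}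
  have hA : ∀ n, MeasurableSet (A n) := fun _ => MeasurableSet.of_discrete
  -- The union bound gives `n * μ (A n)`. The integrand `n · 1_{A n}` is dominated by `x² / ε` and
  -- vanishes eventually at each `x`.
  have hlim : Tendsto (fun n : ℕ => ∫⁻ x, (A n).indicator (fun _ => (n : ℝ≥0∞)) x ∂μ) atTop
      (𝓝 (∫⁻ _, 0 ∂μ)) := by
    refine tendsto_lintegral_of_dominated_convergence
      (fun x => ENNReal.ofReal ε⁻¹ * (x : ℝ≥0∞) ^ 2)
      (fun n => measurable_const.indicator (hA n)) (fun n => ae_of_all _ fun x => ?_) ?_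
      (ae_of_all _ fun x => ?_)
    · refine Set.indicator_apply_le' (fun hx => ?_) fun _ => zero_le
      have hx' : ε * n < (x : ℝ) ^ 2 := hx
      have : (n : ℝ) ≤ ε⁻¹ * (x : ℝ) ^ 2 := by
        rw [inv_mul_eq_div, le_div_iff₀ hε]
        linarith
      have h := ENNReal.ofReal_le_ofReal this
      rwa [ENNReal.ofReal_mul (by positivity), ENNReal.ofReal_pow (by positivity),
        ENNReal.ofReal_natCast, ENNReal.ofReal_natCast] at h
    · rw [lintegral_const_mul _ Measurable.of_discrete]
      exact ENNReal.mul_ne_top ENNReal.ofReal_ne_top hsq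
    · refine tendsto_const_nhds.congr' ?_
      have h : Tendsto (fun n : ℕ => ε * (n : ℝ)) atTop atTop :=
        tendsto_natCast_atTop_atTop.const_mul_atTop hε
      filter_upwards [h.eventually_ge_atTop ((x : ℝ) ^ 2)] with n hn
      exact (Set.indicator_of_notMem (fun hx : x ∈ A n => hn.not_gt hx) _).symm
  rw [lintegral_zero] at hlim
  refine tendsto_of_tendsto_of_tendsto_of_le_of_le tendsto_const_nhds hlim
    (fun _ => zero_le) fun n => ?_
  have hset : {d : Fin n → ℕ | ∃ i, ε * n < (d i : ℝ) ^ 2} =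
      ⋃ i : Fin n, Function.eval i ⁻¹' A n := by
    ext d; simp [A]
  simp only [hset]
  refine (measure_iUnion_le _).trans ?_
  have hmarg : ∀ i : Fin n, iidDegrees n μ (Function.eval i ⁻¹' A n) = μ (A n) := fun i =>
    (measurePreserving_eval (fun _ : Fin n => μ) i).measure_preimage (hA n).nullMeasurableSet
  simp only [hmarg, tsum_fintype, Finset.sum_const, Finset.card_univ, Fintype.card_fin,
    nsmul_eq_mul]
  rw [lintegral_indicator_const (hA n)]

theorem iidDegrees_exists_zero (hpos : ∀ᵐ x ∂μ, 1 ≤ x) (n : ℕ) :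
    iidDegrees n μ {d | ¬ ∀ i, 1 ≤ d i} = 0 := by
  have h : ∀ᵐ d ∂(iidDegrees n μ), ∀ i, 1 ≤ d i := by
    rw [ae_all_iff]
    intro i
    exact (measurePreserving_eval (fun _ : Fin n => μ) i).quasiMeasurePreserving.ae hpos
  exact h

/-- The expectation of `(-1) ^ ∑ dᵢ` is the probability of an even sum minus that of an odd one, and
it factorises by independence. -/
theorem two_mul_evenSum_sub_one (n : ℕ) :
    2 * (iidDegrees n μ).real (evenSum n) - 1 = (∫ x, (-1 : ℝ) ^ x ∂μ) ^ n := by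
  have h := integral_fintype_prod_eq_prod (𝕜 := ℝ) (ι := Fin n) (fun _ (x : ℕ) => (-1 : ℝ) ^ x)
    (μ := fun _ => μ)
  rw [Finset.prod_const, Finset.card_univ, Fintype.card_fin] at h
  rw [← h]
  have hE : MeasurableSet (evenSum n) := Set.Countable.measurableSet (Set.to_countable _)
  have hfun : (fun d : Fin n → ℕ => ∏ i, (-1 : ℝ) ^ d i) =
      fun d => (evenSum n).indicator (fun _ => (2 : ℝ)) d - 1 := by
    funext d
    rw [Finset.prod_pow_eq_pow_sum]
    by_cases hd : d ∈ evenSum n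
    · rw [Set.indicator_of_mem hd, Even.neg_one_pow hd]; norm_num
    · rw [Set.indicator_of_notMem hd, Odd.neg_one_pow (Nat.not_even_iff_odd.1 hd)]; norm_num
  rw [hfun]
  change _ = ∫ d, _ ∂(iidDegrees n μ)
  rw [integral_sub ((integrable_const _).indicator hE) (integrable_const _),
    integral_indicator_const _ hE]
  simp [mul_comm]

/-- The probability of an even sum is either zero or bounded away from zero. -/
theorem exists_le_evenSum : ∃ c : ℝ≥0∞, c ≠ 0 ∧ ∀ n, iidDegrees n μ (evenSum n) ≠ 0 →
    c ≤ iidDegrees n μ (evenSum n) := by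
  set r := ∫ x, (-1 : ℝ) ^ x ∂μ with hr
  have hr1 : |r| ≤ 1 := by
    have := norm_integral_le_of_norm_le_const (μ := μ) (f := fun x : ℕ => (-1 : ℝ) ^ x) (C := 1)
      (ae_of_all _ fun x => by simp)
    simpa using this
  obtain ⟨hr2, hr3⟩ := abs_le.1 hr1
  suffices h : ∃ c : ℝ, 0 < c ∧ ∀ n, (iidDegrees n μ).real (evenSum n) ≠ 0 →
      c ≤ (iidDegrees n μ).real (evenSum n) by
    obtain ⟨c, hc, h⟩ := h
    refine ⟨ENNReal.ofReal c, by simpa using hc, fun n hn => ?_⟩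
    rw [ENNReal.ofReal_le_iff_le_toReal (measure_ne_top _ _)]
    exact h n ((measureReal_ne_zero_iff (measure_ne_top _ _)).2 hn)
  -- If `r = -1`, the probability `(1 + r ^ n) / 2` is 0 or 1. If `r > -1`, it is at least `1/2` or
  -- `(1 + r) / 2`, according to the sign of `r`, for `n > 0`.
  rcases hr2.eq_or_lt with hr4 | hr4
  · refine ⟨1, one_pos, fun n hn => ?_⟩
    have h := two_mul_evenSum_sub_one μ n
    rw [← hr, ← hr4] at h
    rcases neg_one_pow_eq_or ℝ n with e | e <;> rw [e] at h
    · linarith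
    · exact absurd (by linarith) hn
  · have hc : 0 < min (1 / 2) ((1 + r) / 2) := lt_min one_half_pos (by linarith)
    refine ⟨_, hc, fun n _ => ?_⟩
    have h := two_mul_evenSum_sub_one μ n
    rw [← hr] at h
    rcases Nat.eq_zero_or_pos n with rfl | hn0
    · refine (min_le_left _ _).trans ?_
      rw [pow_zero] at h
      linarith
    · rcases le_total 0 r with h0 | h0
      · have := pow_nonneg h0 n
        refine (min_le_left _ _).trans ?_
        linarith
      · refine (min_le_right _ _).trans ?_
        have h1 : |r ^ n| ≤ |r| := by
          rw [abs_pow]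
          exact pow_le_of_le_one (abs_nonneg _) hr1 hn0.ne'
        rw [abs_of_nonpos h0] at h1
        have := (abs_le.1 h1).1
        linarith

end Degrees

/-! ### Satisfiability with high probability -/

section Assembly

/-- `hsum` says `Λ ≤ (2 - δ) M`. Cutting at `K = n / j` leaves `q ≥ (1 - δ/4) M`, so `Λ / (2q)` is
at most the ratio in the bound, which is below 1. -/
theorem formulaLaw_not_satisfiable_le_of_good {n : ℕ} {d : Fin n → ℕ} {δ ε : ℝ} (hδ0 : 0 < δ)
    (hδ1 : δ ≤ 1) (hε : 0 < ε) (j : ℕ) (hj : 16 ≤ δ * j) (hn : 16 ≤ δ * n)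
    (hpos : ∀ i, 1 ≤ d i)
    (hsum : ∑ i, ((d i : ℝ) ^ 2 - 3 * d i + δ * d i) ≤ 0)
    (hmax : ∀ i, (d i : ℝ) ^ 2 ≤ ε * n) :
    formulaLaw d {φ | ¬ φ.Satisfiable} ≤ ENNReal.ofReal
      (2 * ε * ∑' k : ℕ, (k : ℝ) ^ 2 * ((2 - δ) / (2 - δ / 2)) ^ k +
        2 * ε * (n : ℝ) ^ 2 * ((2 - δ) / (2 - δ / 2)) ^ (n / j)) := by
  set ρ := (2 - δ) / (2 - δ / 2) with hρ
  have hden : 0 < 2 - δ / 2 := by linarith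
  have hρ0 : 0 ≤ ρ := div_nonneg (by linarith) hden.le
  have hρ1 : ρ < 1 := by rw [hρ, div_lt_one hden]; linarith
  have hn0 : (0 : ℝ) < n := by
    by_contra h
    have : δ * n ≤ 0 := mul_nonpos_of_nonneg_of_nonpos hδ0.le (not_lt.1 h)
    linarith
  have hj0 : (0 : ℝ) < j := by
    by_contra h
    have : δ * j ≤ 0 := mul_nonpos_of_nonneg_of_nonpos hδ0.le (not_lt.1 h)
    linarith
  set M := ∑ i, d i with hM
  set K := n / j with hK
  have hMn : (n : ℝ) ≤ M := by
    have : n ≤ M := by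
      simpa using Finset.card_nsmul_le_sum Finset.univ d 1 fun i _ => hpos i
    exact_mod_cast this
  -- Both `2K` and `2` are at most `δ n / 8`, by `hj` and `hn` respectively.
  have hKn : 2 * ((K : ℝ) + 1) ≤ δ / 4 * n := by
    have h1 : (K : ℝ) ≤ n / j := Nat.cast_div_le
    have h2 : (n : ℝ) / j ≤ δ * n / 16 := by
      rw [div_le_div_iff₀ hj0 (by norm_num)]
      nlinarith
    linarith
  have hKM : 2 * ((K : ℝ) + 1) ≤ δ / 4 * M := hKn.trans (by gcongr)
  have hKM' : 2 * (K + 1) ≤ M := by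
    have : 2 * ((K : ℝ) + 1) ≤ M := hKM.trans (by nlinarith)
    exact_mod_cast this
  obtain ⟨q, hq⟩ : ∃ q, q + 2 * (K + 1) = M := ⟨M - 2 * (K + 1), by omega⟩
  have hqM : (1 - δ / 4) * M ≤ (q : ℝ) := by
    have : (q : ℝ) + 2 * (K + 1) = M := by exact_mod_cast hq
    linarith
  have hqn : (n : ℝ) / 2 ≤ q := by nlinarith
  have hq0 : (0 : ℝ) < q := by linarith
  set D := ⌊√(ε * n)⌋₊ with hD
  have hdD : ∀ i, d i ≤ D := fun i => Nat.le_floor (Real.le_sqrt_of_sq_le (hmax i))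
  have hD2 : (D : ℝ) ^ 2 ≤ ε * n := by
    have h := Nat.floor_le (Real.sqrt_nonneg (ε * n))
    calc (D : ℝ) ^ 2 ≤ √(ε * n) ^ 2 := by gcongr
      _ = ε * n := Real.sq_sqrt (by positivity)
  -- Crude, but a polynomial bound on the choices of free ends suffices against `ρ ^ K`.
  have hMD : (M : ℝ) ^ 2 ≤ n ^ 2 * (ε * n) := by
    have h1 : M ≤ n * D := by
      simpa using Finset.sum_le_card_nsmul Finset.univ d D fun i _ => hdD i
    have h2 : (M : ℝ) ≤ n * D := by exact_mod_cast h1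
    calc (M : ℝ) ^ 2 ≤ (n * D) ^ 2 := by gcongr
      _ = n ^ 2 * (D : ℝ) ^ 2 := by ring
      _ ≤ _ := by gcongr
  have hlink : ((∑ i, d i * (d i - 1) : ℕ) : ℝ) ≤ ρ * (2 * q) := by
    have h1 : ((∑ i, d i * (d i - 1) : ℕ) : ℝ) = ∑ i, ((d i : ℝ) ^ 2 - d i) := by
      rw [Nat.cast_sum]
      refine Finset.sum_congr rfl fun i _ => ?_
      rw [Nat.cast_mul, Nat.cast_sub (hpos i)]
      push_cast; ring
    have h2 : ∑ i, ((d i : ℝ) ^ 2 - d i) ≤ (2 - δ) * M := by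
      have h3 : ∑ i, ((d i : ℝ) ^ 2 - 3 * d i + δ * d i) =
          ∑ i, ((d i : ℝ) ^ 2 - d i) - (2 - δ) * M := by
        rw [hM, Nat.cast_sum, Finset.mul_sum, ← Finset.sum_sub_distrib]
        exact Finset.sum_congr rfl fun i _ => by ring
      linarith
    rw [h1]
    refine h2.trans ?_
    calc (2 - δ) * M = ρ * ((2 - δ / 2) * M) := by
          rw [hρ, ← mul_assoc, div_mul_cancel₀ _ hden.ne']
      _ ≤ _ := mul_le_mul_of_nonneg_left (by linarith) hρ0
  refine (formulaLaw_not_satisfiable_le D hdD K q (Nat.cast_pos.1 hq0) hq.le ρ hlink).trans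
    (ENNReal.ofReal_le_ofReal (add_le_add ?_ ?_))
  · have hsummable : Summable fun k : ℕ => (k : ℝ) ^ 2 * ρ ^ k :=
      summable_pow_mul_geometric_of_norm_lt_one 2 (by rwa [Real.norm_of_nonneg hρ0])
    have hDq : (D : ℝ) ^ 2 / q ≤ 2 * ε := by
      rw [div_le_iff₀ hq0]
      nlinarith
    calc ∑ k ∈ Finset.range K, ((k * D : ℝ) ^ 2 / q * ρ ^ k)
        = (D : ℝ) ^ 2 / q * ∑ k ∈ Finset.range K, (k : ℝ) ^ 2 * ρ ^ k := by
          rw [Finset.mul_sum]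
          exact Finset.sum_congr rfl fun k _ => by ring
      _ ≤ _ := by
          gcongr
          exact hsummable.sum_le_tsum _ fun k _ => by positivity
  · refine mul_le_mul_of_nonneg_right ?_ (by positivity)
    rw [div_le_iff₀ hq0]
    refine hMD.trans ?_
    have : 0 ≤ ε * (n : ℝ) ^ 2 := by positivity
    nlinarith

theorem tendsto_sq_mul_pow_div {ρ : ℝ} (hρ0 : 0 < ρ) (hρ1 : ρ < 1) {j : ℕ} (hj : 0 < j) :
    Tendsto (fun n : ℕ => (n : ℝ) ^ 2 * ρ ^ (n / j)) atTop (𝓝 0) := by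
  have h1 : Tendsto (fun m : ℕ => ((m : ℝ) ^ 2 * ρ ^ m)) atTop (𝓝 0) :=
    tendsto_pow_const_mul_const_pow_of_abs_lt_one 2 (by rwa [abs_of_pos hρ0])
  have h2 : Tendsto (fun n : ℕ => (j : ℝ) ^ 2 * ρ⁻¹ *
      (((n / j + 1 : ℕ) : ℝ) ^ 2 * ρ ^ (n / j + 1))) atTop (𝓝 ((j : ℝ) ^ 2 * ρ⁻¹ * 0)) :=
    ((h1.comp (tendsto_add_atTop_nat 1)).comp (Nat.tendsto_div_const_atTop hj.ne')).const_mul _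
  rw [mul_zero] at h2
  refine squeeze_zero (fun n => by positivity) (fun n => ?_) h2
  have h3 : (n : ℝ) ≤ j * ((n / j + 1 : ℕ) : ℝ) := by
    exact_mod_cast (Nat.lt_mul_div_succ n hj).le
  calc (n : ℝ) ^ 2 * ρ ^ (n / j) ≤ (j * ((n / j + 1 : ℕ) : ℝ)) ^ 2 * ρ ^ (n / j) := by gcongr
    _ = _ := by
      rw [pow_succ ρ]
      field_simp

variable (μ : Measure ℕ)

theorem integrable_natCast_sq (hsq : ∫⁻ x, (x : ℝ≥0∞) ^ 2 ∂μ ≠ ∞) :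
    Integrable (fun x : ℕ => (x : ℝ) ^ 2) μ := by
  refine ⟨Measurable.of_discrete.aestronglyMeasurable, ?_⟩
  rw [hasFiniteIntegral_iff_ofReal (ae_of_all _ fun x => by positivity)]
  refine lt_of_eq_of_lt (lintegral_congr fun x => ?_) hsq.lt_top
  rw [ENNReal.ofReal_pow (by positivity), ENNReal.ofReal_natCast]

/-- The strict inequality makes the second moment finite and leaves room for a small multiple of the
mean. -/
theorem exists_slack (hmom : ∫⁻ x, (x : ℝ≥0∞) ^ 2 ∂μ < 3 * ∫⁻ x, (x : ℝ≥0∞) ∂μ) :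
    ∃ δ : ℝ, 0 < δ ∧ δ ≤ 1 ∧
      Integrable (fun x : ℕ => (x : ℝ) ^ 2 - 3 * x + δ * x) μ ∧
      ∫ x : ℕ, ((x : ℝ) ^ 2 - 3 * x + δ * x) ∂μ < 0 := by
  have hsq : Integrable (fun x : ℕ => (x : ℝ) ^ 2) μ := integrable_natCast_sq μ hmom.ne_top
  have hid : Integrable (fun x : ℕ => (x : ℝ)) μ := by
    refine hsq.mono' Measurable.of_discrete.aestronglyMeasurable (ae_of_all _ fun x => ?_)
    rw [Real.norm_natCast]
    exact_mod_cast Nat.le_self_pow two_ne_zero x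
  have e1 : ∫⁻ x, (x : ℝ≥0∞) ^ 2 ∂μ = ENNReal.ofReal (∫ x : ℕ, (x : ℝ) ^ 2 ∂μ) := by
    rw [ofReal_integral_eq_lintegral_ofReal hsq (ae_of_all _ fun x => by positivity)]
    refine lintegral_congr fun x => ?_
    rw [ENNReal.ofReal_pow (by positivity), ENNReal.ofReal_natCast]
  have e2 : ∫⁻ x, (x : ℝ≥0∞) ∂μ = ENNReal.ofReal (∫ x : ℕ, (x : ℝ) ∂μ) := by
    rw [ofReal_integral_eq_lintegral_ofReal hid (ae_of_all _ fun x => by positivity)]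
    exact lintegral_congr fun x => by rw [ENNReal.ofReal_natCast]
  have e3 : (3 : ℝ≥0∞) = ENNReal.ofReal 3 := by simp
  rw [e1, e2, e3, ← ENNReal.ofReal_mul (by norm_num), ENNReal.ofReal_lt_ofReal_iff'] at hmom
  set A := ∫ x : ℕ, (x : ℝ) ^ 2 ∂μ
  have hB : 0 ≤ ∫ x : ℕ, (x : ℝ) ∂μ := integral_nonneg fun x => by positivity
  set B := ∫ x : ℕ, (x : ℝ) ∂μ
  have hAB : 0 < 3 * B - A := by linarith [hmom.1]
  have hsub : Integrable (fun x : ℕ => (x : ℝ) ^ 2 - 3 * x) μ := hsq.sub (hid.const_mul 3)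
  -- Dividing by `B + 1` rather than `B` makes `δ * B < 3 * B - A` strict.
  refine ⟨min 1 ((3 * B - A) / (B + 1)), lt_min one_pos (by positivity), min_le_left _ _,
    hsub.add (hid.const_mul _), ?_⟩
  rw [integral_add hsub (hid.const_mul _),
    integral_sub hsq (hid.const_mul 3), integral_const_mul, integral_const_mul]
  change A - 3 * B + _ * B < 0
  have h1 : min 1 ((3 * B - A) / (B + 1)) * B ≤ (3 * B - A) / (B + 1) * B :=
    mul_le_mul_of_nonneg_right (min_le_right _ _) hB
  have h2 : (3 * B - A) / (B + 1) * B < 3 * B - A := by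
    rw [div_mul_eq_mul_div, div_lt_iff₀ (by positivity)]
    nlinarith
  linarith

theorem configModel_apply (n : ℕ) (s : Set (TwoCNF n)) :
    configModel n μ s = ∫⁻ d, formulaLaw d s ∂(degreeLaw n μ) :=
  Measure.bind_apply MeasurableSpace.measurableSet_top Measurable.of_discrete.aemeasurable

theorem ae_even_degreeLaw (n : ℕ) : ∀ᵐ d ∂(degreeLaw n μ), Even (∑ i, d i) :=
  ae_cond_mem (Set.Countable.measurableSet (Set.to_countable _))

theorem isProbabilityMeasure_degreeLaw [IsProbabilityMeasure μ] {n : ℕ}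
    (h : iidDegrees n μ (evenSum n) ≠ 0) :
    IsProbabilityMeasure (degreeLaw n μ) :=
  cond_isProbabilityMeasure h

theorem isProbabilityMeasure_configModel [IsProbabilityMeasure μ] {n : ℕ}
    (h : iidDegrees n μ (evenSum n) ≠ 0) :
    IsProbabilityMeasure (configModel n μ) := by
  have := isProbabilityMeasure_degreeLaw μ h
  refine ⟨?_⟩
  rw [configModel_apply]
  have : ∀ᵐ d ∂(degreeLaw n μ), formulaLaw d Set.univ = 1 := by
    filter_upwards [ae_even_degreeLaw μ n] with d hd
    exact (isProbabilityMeasure_formulaLaw hd).measure_univ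
  rw [lintegral_congr_ae this]
  simp

/-- Bad degree sequences contribute at most their conditional probability, and conditioning inflates
it by at most the inverse probability of an even sum. -/
theorem configModel_le [IsProbabilityMeasure μ] {n : ℕ}
    (h : iidDegrees n μ (evenSum n) ≠ 0) (s : Set (TwoCNF n))
    (G : Set (Fin n → ℕ)) (b : ℝ≥0∞) (hG : ∀ d ∈ G, formulaLaw d s ≤ b) :
    configModel n μ s ≤ (iidDegrees n μ (evenSum n))⁻¹ * iidDegrees n μ Gᶜ + b := by
  have := isProbabilityMeasure_degreeLaw μ h
  have hm : ∀ t : Set (Fin n → ℕ), MeasurableSet t := fun t =>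
    Set.Countable.measurableSet (Set.to_countable _)
  rw [configModel_apply]
  have h1 : ∀ᵐ d ∂(degreeLaw n μ), formulaLaw d s ≤ Gᶜ.indicator (fun _ => 1) d + b := by
    filter_upwards [ae_even_degreeLaw μ n] with d hd
    by_cases hdG : d ∈ G
    · exact (hG d hdG).trans le_add_self
    · rw [Set.indicator_of_mem hdG]
      have := isProbabilityMeasure_formulaLaw hd
      exact prob_le_one.trans le_self_add
  refine (lintegral_mono_ae h1).trans ?_
  rw [lintegral_add_right _ measurable_const, lintegral_indicator_const (hm _), one_mul,
    lintegral_const, measure_univ, mul_one]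
  gcongr
  rw [degreeLaw, cond_apply (hm _)]
  gcongr
  exact Set.inter_subset_right

theorem tendsto_configModel_not_satisfiable [IsProbabilityMeasure μ] (hpos : ∀ᵐ x ∂μ, 1 ≤ x)
    (hmom : ∫⁻ x, (x : ℝ≥0∞) ^ 2 ∂μ < 3 * ∫⁻ x, (x : ℝ≥0∞) ∂μ) :
    Tendsto (fun n : ℕ => configModel n μ {φ | ¬ φ.Satisfiable})
      (atTop ⊓ 𝓟 {n : ℕ | iidDegrees n μ (evenSum n) ≠ 0}) (𝓝 0) := by
  obtain ⟨δ, hδ0, hδ1, hint, hneg⟩ := exists_slack μ hmom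
  obtain ⟨c, hc0, hc⟩ := exists_le_evenSum μ
  obtain ⟨j, hj⟩ := exists_nat_ge (16 / δ)
  rw [div_le_iff₀' hδ0] at hj
  have hj0 : 0 < j := by
    rcases Nat.eq_zero_or_pos j with rfl | h
    · norm_num at hj
    · exact h
  set ρ := (2 - δ) / (2 - δ / 2) with hρ
  have hden : 0 < 2 - δ / 2 := by linarith
  have hρ0 : 0 < ρ := div_pos (by linarith) hden
  have hρ1 : ρ < 1 := by rw [hρ, div_lt_one hden]; linarith
  set C := ∑' k : ℕ, (k : ℝ) ^ 2 * ρ ^ k with hC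
  rw [ENNReal.tendsto_nhds_zero]
  intro η hη
  -- For fixed `ε` the bound on short bicycles tends to `2 * ε * C`, not to 0, so `ε` is chosen in
  -- terms of `η`.
  obtain ⟨ε, hεη, hε⟩ : ∃ ε : ℝ, ENNReal.ofReal (2 * ε * C) < η ∧ 0 < ε := by
    have hcont : Tendsto (fun ε : ℝ => ENNReal.ofReal (2 * ε * C)) (𝓝[>] 0)
        (𝓝 (ENNReal.ofReal (2 * 0 * C))) :=
      tendsto_nhdsWithin_of_tendsto_nhds (Continuous.tendsto
        (ENNReal.continuous_ofReal.comp (by fun_prop)) 0)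
    rw [mul_zero, zero_mul, ENNReal.ofReal_zero] at hcont
    exact ((hcont.eventually_lt_const hη).and self_mem_nhdsWithin).exists
  let b : ℕ → ℝ≥0∞ := fun n => ENNReal.ofReal (2 * ε * C + 2 * ε * (n : ℝ) ^ 2 * ρ ^ (n / j))
  let B₁ : (n : ℕ) → Set (Fin n → ℕ) := fun n =>
    {d | 0 < ∑ i, ((d i : ℝ) ^ 2 - 3 * d i + δ * d i)}
  let B₂ : (n : ℕ) → Set (Fin n → ℕ) := fun n => {d | ∃ i, ε * n < (d i : ℝ) ^ 2}
  have hb : Tendsto b atTop (𝓝 (ENNReal.ofReal (2 * ε * C))) := by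
    refine ENNReal.tendsto_ofReal ?_
    have h := ((tendsto_sq_mul_pow_div hρ0 hρ1 hj0).const_mul (2 * ε)).const_add (2 * ε * C)
    simpa only [mul_zero, add_zero, mul_assoc] using h
  have h1 : Tendsto (fun n => iidDegrees n μ (B₁ n)) atTop (𝓝 0) :=
    tendsto_iidDegrees_sum_pos μ (fun x => (x : ℝ) ^ 2 - 3 * x + δ * x) hint hneg
  have h2 : Tendsto (fun n => iidDegrees n μ (B₂ n)) atTop (𝓝 0) :=
    tendsto_iidDegrees_exists_sq_gt μ hmom.ne_top hε
  have hlim : Tendsto (fun n => c⁻¹ * (iidDegrees n μ (B₁ n) + iidDegrees n μ (B₂ n)) + b n) atTop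
      (𝓝 (ENNReal.ofReal (2 * ε * C))) := by
    have h := (ENNReal.Tendsto.const_mul (a := c⁻¹) (h1.add h2)
      (Or.inr (ENNReal.inv_ne_top.2 hc0))).add hb
    simpa only [add_zero, mul_zero, zero_add] using h
  rw [eventually_inf_principal]
  have hlarge : ∀ᶠ n : ℕ in atTop, 16 ≤ δ * n :=
    (tendsto_natCast_atTop_atTop.const_mul_atTop hδ0).eventually_ge_atTop 16
  filter_upwards [hlim.eventually_lt_const hεη, hlarge] with n hn hn16 heven
  refine le_trans ?_ hn.le
  refine (configModel_le μ heven _ ({d | ∀ i, 1 ≤ d i} \ (B₁ n ∪ B₂ n)) (b n) ?_).trans ?_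
  · rintro d ⟨hd, hd'⟩
    simp only [B₁, B₂, Set.mem_union, Set.mem_ofPred_eq, not_or, not_lt, not_exists] at hd'
    exact formulaLaw_not_satisfiable_le_of_good hδ0 hδ1 hε j hj hn16 hd hd'.1 hd'.2
  · gcongr
    · exact hc n heven
    · have hsub : ({d : Fin n → ℕ | ∀ i, 1 ≤ d i} \ (B₁ n ∪ B₂ n))ᶜ ⊆
          {d | ¬ ∀ i, 1 ≤ d i} ∪ (B₁ n ∪ B₂ n) := by
        intro d hd
        by_cases h : ∀ i, 1 ≤ d i
        · exact Or.inr (by_contra fun h' => hd ⟨h, h'⟩)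
        · exact Or.inl h
      refine (measure_mono hsub).trans ((measure_union_le _ _).trans ?_)
      rw [iidDegrees_exists_zero μ hpos, zero_add]
      exact measure_union_le _ _

theorem tendsto_configModel_satisfiable [IsProbabilityMeasure μ] (hpos : ∀ᵐ x ∂μ, 1 ≤ x)
    (hmom : ∫⁻ x, (x : ℝ≥0∞) ^ 2 ∂μ < 3 * ∫⁻ x, (x : ℝ≥0∞) ∂μ) :
    Tendsto (fun n : ℕ => configModel n μ {φ | φ.Satisfiable})
      (atTop ⊓ 𝓟 {n : ℕ | iidDegrees n μ (evenSum n) ≠ 0}) (𝓝 1) := by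
  have h := ENNReal.Tendsto.sub (tendsto_const_nhds (x := (1 : ℝ≥0∞)))
    (tendsto_configModel_not_satisfiable μ hpos hmom) (Or.inl ENNReal.one_ne_top)
  rw [tsub_zero] at h
  refine h.congr' ?_
  -- Passing to the complement needs total mass 1, which holds for the `n` where an even sum is
  -- possible.
  filter_upwards [mem_inf_of_right (mem_principal_self _)] with n hn
  have := isProbabilityMeasure_configModel μ hn
  rw [← prob_compl_eq_one_sub MeasurableSpace.measurableSet_top]
  congr 1
  ext φ
  simp

end Assembly

end RandomTwoSat

theorem proposition3 {Ω : Type*} [MeasurableSpace Ω] (P : Measure Ω) [IsProbabilityMeasure P]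
    (ξ : Ω → ℕ) (α : ℝ) (hξ : RandomTwoSat.IsPowerLaw P ξ α)
    (hmom : ∫⁻ ω, (ξ ω : ℝ≥0∞) ^ 2 ∂P < 3 * ∫⁻ ω, (ξ ω : ℝ≥0∞) ∂P) :
    Tendsto
      (fun n : ℕ => RandomTwoSat.configModel n (P.map ξ) {φ | φ.Satisfiable})
      (atTop ⊓ 𝓟 {n : ℕ |
        RandomTwoSat.iidDegrees n (P.map ξ) (RandomTwoSat.evenSum n) ≠ 0})
      (𝓝 1) := by
  have := Measure.isProbabilityMeasure_map (μ := P) hξ.measurable.aemeasurable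
  refine RandomTwoSat.tendsto_configModel_satisfiable (P.map ξ) ?_ ?_
  · exact (ae_map_iff hξ.measurable.aemeasurable MeasurableSet.of_discrete).2 hξ.pos
  · rwa [lintegral_map Measurable.of_discrete hξ.measurable,
      lintegral_map Measurable.of_discrete hξ.measurable]
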